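/- **General metric compression.** Logarithms are to base $2$. For an integer $n\ge 0$ and reals $0<\epsilon<1$ and $\Phi\ge 2$, consider the *general metric sketching problem*: the input is a metric $\mathrm d$ on $[n]=\{1,\dots,n\}$ with $1\le \mathrm d(i,j)\le\Phi$ for all $i\ne j$; a *sketching algorithm* maps $\mathrm d$ to a bitstring (the sketch); an *estimation algorithm* maps the sketch alone to numbers $\widetilde E_{ij}$, $i,j\in[n]$. A sketch is *valid* for $\mathrm d$ if $(1-\epsilon)\,\mathrm d(i,j)\le \widetilde E_{ij}\le(1+\epsilon)\,\mathrm d(i,j)$ for all $i,j\in[n]$ simultaneously. A scheme (a pair of such algorithms, which may depend on $n,\epsilon,\Phi$) uses $b$ bits if its sketches always have length at most $b$; no bound on running time is imposed. It is deterministic if the sketching algorithm is deterministic and the sketch is valid for every input. It is randomized with failure probability $\delta$ if the sketching algorithm is randomized, the estimation algorithm is deterministic, and for every input the sketch is valid with probability at least $1-\delta$. Then $\Theta(n^2\log(1/\epsilon)+n\log\log\Phi)$ bits are both sufficient and necessary, that is: 1. (Sufficient.) For every $\epsilon_1<1$ there is a constant $C>0$, depending only on $\epsilon_1$, such that for all $n\ge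 0$, $0<\epsilon\le\epsilon_1$ and $\Phi\ge2$ there is a deterministic scheme that uses at most $C\,(n^2\log(1/\epsilon)+n\log\log\Phi)$ bits. 2. (Necessary.) There is an absolute constant $c>0$ such that for all $n\ge2$, $0<\epsilon<1/3$, $\Phi\ge2$ and $0\le\delta<1$, every scheme, even a randomized one with failure probability $\delta$, that uses $b$ bits satisfies $b\ge c\,(n^2\log(1/\epsilon)+n\log\log\Phi)$. -/

import Mathlib

/-- A metric on the point set `[n]` in which every two distinct points are at distance
in the range `[1, Φ]`: an input of the general metric sketching problem. -/
structure BoundedMetric (n : ℕ) (Φ : ℝ) where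
  metric : MetricSpace (Fin n)
  one_le_dist : ∀ i j : Fin n, i ≠ j → 1 ≤ metric.dist i j
  dist_le : ∀ i j : Fin n, i ≠ j → metric.dist i j ≤ Φ

/-- The table `E` of distance estimates has distortion `1 ± ε`, for all pairs of points. -/
def HasDistortion {n : ℕ} {Φ : ℝ} (ε : ℝ) (d : BoundedMetric n Φ)
    (E : Fin n → Fin n → ℝ) : Prop :=
  ∀ i j : Fin n, (1 - ε) * d.metric.dist i j ≤ E i j ∧ E i j ≤ (1 + ε) * d.metric.dist i j

/-- General metric sketching with `n` points, distances in `[1, Φ]` and distortion `1 ± ε` can be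
done deterministically with `b` bits: there are a sketching map, which maps each metric to a
bitstring of length at most `b`, and an estimation map, which computes valid estimates of all the
distances from the bitstring alone. -/
def Sketchable (n : ℕ) (ε Φ : ℝ) (b : ℕ) : Prop :=
  ∃ (sketch : BoundedMetric n Φ → List Bool) (estimate : List Bool → Fin n → Fin n → ℝ),
    ∀ d : BoundedMetric n Φ,
      (sketch d).length ≤ b ∧ HasDistortion ε d (estimate (sketch d))

/-- The same with a randomized sketching map and a deterministic estimation map: the sketch of
a metric is a random bitstring, always of length at most `b`, and with probability at least `1 - δ`
it yields valid estimates for all pairs of points simultaneously. -/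
def RandomizedSketchable (n : ℕ) (ε Φ δ : ℝ) (b : ℕ) : Prop :=
  ∃ (sketch : BoundedMetric n Φ → PMF (List Bool)) (estimate : List Bool → Fin n → Fin n → ℝ),
    ∀ d : BoundedMetric n Φ,
      (∀ s ∈ (sketch d).support, s.length ≤ b) ∧
      ENNReal.ofReal (1 - δ) ≤ (sketch d).toOuterMeasure {s | HasDistortion ε d (estimate s)}

/-- The number of bits `n² log(1/ε) + n log log Φ`, with logarithms to base `2`. -/
noncomputable def sketchBits (n : ℕ) (ε Φ : ℝ) : ℝ :=
  (n : ℝ) ^ 2 * Real.logb 2 (1 / ε) + (n : ℝ) * Real.logb 2 (Real.logb 2 Φ)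

/-! ### Lower bound: packings of metrics -/

theorem card_lists_length_le_lt {ι : Type*} [Fintype ι] {b : ℕ} (f : ι → List Bool)
    (hf : Function.Injective f) (hb : ∀ a, (f a).length ≤ b) :
    Fintype.card ι < 2 ^ (b + 1) := by
  let g : ι → (Σ k : Fin (b + 1), List.Vector Bool k) :=
    fun a ↦ ⟨⟨(f a).length, Nat.lt_succ_of_le (hb a)⟩, ⟨f a, rfl⟩⟩
  have hg : Function.Injective g := by
    have hl : ∀ a, (g a).2.toList = f a := fun _ ↦ rfl
    intro a a' h
    apply hf
    rw [← hl a, ← hl a', h]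
  calc Fintype.card ι ≤ Fintype.card (Σ k : Fin (b + 1), List.Vector Bool k) :=
        Fintype.card_le_of_injective g hg
    _ = ∑ k ∈ Finset.range (b + 1), 2 ^ k := by
        simp [Fintype.card_sigma, Fin.sum_univ_eq_sum_range (fun k ↦ 2 ^ k)]
    _ < 2 ^ (b + 1) := Nat.geomSum_lt le_rfl (by simp)

/-- Metrics for which no table of estimates is valid simultaneously need distinct sketches. -/
theorem logb_card_le_of_randomizedSketchable {n : ℕ} {ε Φ δ : ℝ} {b : ℕ} {ι : Type*} [Fintype ι]
    [Nonempty ι] (d : ι → BoundedMetric n Φ)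
    (hd : ∀ a a', a ≠ a' → ∀ E, HasDistortion ε (d a) E → ¬ HasDistortion ε (d a') E)
    (hδ : δ < 1) (h : RandomizedSketchable n ε Φ δ b) :
    Real.logb 2 (Fintype.card ι) ≤ 2 * b := by
  obtain ⟨sketch, estimate, H⟩ := h
  have hs : ∀ m, ∃ s ∈ (sketch m).support, HasDistortion ε m (estimate s) := by
    intro m
    have hpos : (sketch m).toOuterMeasure {s | HasDistortion ε m (estimate s)} ≠ 0 := by
      refine (lt_of_lt_of_le ?_ (H m).2).ne'
      simpa using hδ
    rw [Ne, PMF.toOuterMeasure_apply_eq_zero_iff, Set.not_disjoint_iff] at hpos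
    exact hpos
  choose s hs hE using hs
  have hcard := card_lists_length_le_lt (b := b) (fun a ↦ s (d a))
    (fun a a' haa ↦ by
      by_contra hne
      refine hd a a' hne _ (hE (d a)) ?_
      have : s (d a) = s (d a') := haa
      rw [this]
      exact hE (d a'))
    (fun a ↦ (H (d a)).1 _ (hs _))
  have hle : Fintype.card ι ≤ 2 ^ (2 * b) := by
    -- `b + 1 ≤ 2 * b` fails only for `b = 0`, where the family is a single metric.
    rcases Nat.eq_zero_or_pos b with rfl | hb
    · simp at hcard ⊢
      omega
    · exact hcard.le.trans (Nat.pow_le_pow_right (by norm_num) (by omega))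
  have hpos : (0 : ℝ) < Fintype.card ι := by exact_mod_cast Fintype.card_pos
  calc Real.logb 2 (Fintype.card ι) ≤ Real.logb 2 (2 ^ (2 * b)) :=
        Real.logb_le_logb_of_le (by norm_num) hpos (by exact_mod_cast hle)
    _ = 2 * b := by rw [Real.logb_pow]; simp

theorem HasDistortion.not_of_lt {n : ℕ} {ε Φ : ℝ} {d d' : BoundedMetric n Φ}
    {E : Fin n → Fin n → ℝ} {i j : Fin n}
    (hlt : (1 + ε) * d.metric.dist i j < (1 - ε) * d'.metric.dist i j ∨
      (1 + ε) * d'.metric.dist i j < (1 - ε) * d.metric.dist i j)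
    (h : HasDistortion ε d E) : ¬ HasDistortion ε d' E := by
  intro h'
  have h1 := h i j
  have h2 := h' i j
  rcases hlt with hlt | hlt <;> linarith [h1.1, h1.2, h2.1, h2.2]

/-- The metric with arbitrarily prescribed distances in `[1, 2]`. -/
noncomputable def BoundedMetric.ofSym2 {n : ℕ} {Φ : ℝ} (hΦ : 2 ≤ Φ)
    (w : {z : Sym2 (Fin n) // ¬ z.IsDiag} → ℝ) (hw : ∀ z, w z ∈ Set.Icc 1 2) :
    BoundedMetric n Φ where
  metric :=
    { dist := fun i j ↦ if h : i = j then 0 else w ⟨s(i, j), by simpa using h⟩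
      dist_self := fun i ↦ by simp
      dist_comm := fun i j ↦ by
        by_cases h : i = j
        · simp [h]
        · simp only [h, Ne.symm h, dite_false, Sym2.eq_swap]
      dist_triangle := fun i j k ↦ by
        by_cases hij : i = j
        · subst hij; simp
        by_cases hjk : j = k
        · subst hjk; simp
        by_cases hik : i = k
        · subst hik
          simp only [hij, hjk, dite_false, dite_true]
          linarith [(hw ⟨s(i, j), by simpa using hij⟩).1, (hw ⟨s(j, i), by simpa using hjk⟩).1]
        · simp only [hij, hjk, hik, dite_false]
          linarith [(hw ⟨s(i, j), by simpa using hij⟩).1, (hw ⟨s(j, k), by simpa using hjk⟩).1,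
            (hw ⟨s(i, k), by simpa using hik⟩).2]
      eq_of_dist_eq_zero := fun {i j} h ↦ by
        by_contra hij
        have h' : (if h : i = j then 0 else w ⟨s(i, j), by simpa using h⟩) = 0 := h
        simp only [hij, dite_false] at h'
        linarith [(hw ⟨s(i, j), by simpa using hij⟩).1] }
  one_le_dist := fun i j hij ↦ by
    change 1 ≤ (if h : i = j then 0 else w ⟨s(i, j), by simpa using h⟩)
    simpa only [hij, dite_false] using (hw _).1
  dist_le := fun i j hij ↦ by
    change (if h : i = j then 0 else w ⟨s(i, j), by simpa using h⟩) ≤ Φ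
    simpa only [hij, dite_false] using (hw _).2.trans hΦ

theorem BoundedMetric.ofSym2_dist {n : ℕ} {Φ : ℝ} (hΦ : 2 ≤ Φ)
    (w : {z : Sym2 (Fin n) // ¬ z.IsDiag} → ℝ) (hw : ∀ z, w z ∈ Set.Icc 1 2) {i j : Fin n}
    (hij : ¬ s(i, j).IsDiag) :
    (BoundedMetric.ofSym2 hΦ w hw).metric.dist i j = w ⟨s(i, j), hij⟩ := by
  have hne : i ≠ j := by simpa using hij
  change (if h : i = j then 0 else w ⟨s(i, j), by simpa using h⟩) = _
  simp only [hne, dite_false]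

/-- The star-like ultrametric whose distances are the maxima of the weights of the two points. -/
noncomputable def BoundedMetric.ofMax {n : ℕ} {Φ : ℝ} (w : Fin n → ℝ)
    (hw : ∀ i j, i ≠ j → 1 ≤ max (w i) (w j)) (hΦ : ∀ i, w i ≤ Φ) : BoundedMetric n Φ where
  metric :=
    { dist := fun i j ↦ if i = j then 0 else max (w i) (w j)
      dist_self := fun i ↦ by simp
      dist_comm := fun i j ↦ by simp only [eq_comm, max_comm]
      dist_triangle := fun i j k ↦ by
        by_cases hij : i = j
        · subst hij; simp
        by_cases hjk : j = k
        · subst hjk; simp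
        have h1 := hw i j hij
        have h2 := hw j k hjk
        by_cases hik : i = k
        · simp only [hjk, hik, if_false, if_true] at h1 ⊢
          split_ifs <;> linarith
        · simp only [hij, hjk, hik, if_false]
          refine max_le ?_ ?_
          · linarith [le_max_left (w i) (w j)]
          · linarith [le_max_right (w j) (w k)]
      eq_of_dist_eq_zero := fun {i j} h ↦ by
        by_contra hij
        have h' : (if i = j then 0 else max (w i) (w j)) = 0 := h
        rw [if_neg hij] at h'
        linarith [hw i j hij] }
  one_le_dist := fun i j hij ↦ by
    change 1 ≤ (if i = j then 0 else max (w i) (w j))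
    simpa only [hij, if_false] using hw i j hij
  dist_le := fun i j hij ↦ by
    change (if i = j then 0 else max (w i) (w j)) ≤ Φ
    simpa only [hij, if_false] using max_le (hΦ i) (hΦ j)

theorem BoundedMetric.ofMax_dist {n : ℕ} {Φ : ℝ} (w : Fin n → ℝ)
    (hw : ∀ i j, i ≠ j → 1 ≤ max (w i) (w j)) (hΦ : ∀ i, w i ≤ Φ) {i j : Fin n} (hij : i ≠ j) :
    (BoundedMetric.ofMax w hw hΦ).metric.dist i j = max (w i) (w j) :=
  if_neg hij

/-- The tightest case is the top pair `k = m - 1`, `l = m`, where the inequality is exactly `4εm < 1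
+ ε`. -/
theorem arithmetic_ratio_lt {ε : ℝ} {m : ℕ} (hm : 0 < m) (hε : 0 < ε)
    (hmε : 4 * ε * m < 1 + ε) {k l : Fin (m + 1)} (hkl : k < l) :
    (1 + ε) * (1 + (k : ℝ) / m) < (1 - ε) * (1 + (l : ℝ) / m) := by
  have hm' : (0 : ℝ) < m := by exact_mod_cast hm
  have hkl' : (k : ℝ) + 1 ≤ l := by exact_mod_cast hkl
  have hlm : (l : ℝ) ≤ m := by exact_mod_cast Nat.lt_succ_iff.mp l.2
  have e1 : (1 + ε) * (1 + (k : ℝ) / m) = (1 + ε) * (m + k) / m := by field_simp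
  have e2 : (1 - ε) * (1 + (l : ℝ) / m) = (1 - ε) * (m + l) / m := by field_simp
  have hm1 : (1 : ℝ) ≤ m := by exact_mod_cast hm
  have hε1 : 0 ≤ 1 - ε := by nlinarith
  rw [e1, e2, div_lt_div_iff_of_pos_right hm']
  nlinarith [mul_nonneg hε1 (sub_nonneg.2 hkl'),
    mul_nonneg hε.le (sub_nonneg.2 (hkl'.trans hlm))]

theorem sq_mul_logb_le_of_randomizedSketchable {n : ℕ} {ε Φ δ : ℝ} {b : ℕ} (hn : 2 ≤ n)
    (hε : 0 < ε) (hε' : ε < 1 / 3) (hΦ : 2 ≤ Φ) (hδ : δ < 1)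
    (h : RandomizedSketchable n ε Φ δ b) :
    (n : ℝ) ^ 2 * Real.logb 2 (1 / ε) ≤ 24 * b := by
  -- Take `m = ⌊1/(4ε)⌋`, or `m = 1` if that vanishes; `m = 1` is admissible exactly because `ε <
  -- 1/3`. The cube absorbs the factor `4` in `1/ε ≤ 4(m + 1)`, as `m + 1 ≥ 2`.
  obtain ⟨m, hm, hmε, hcube⟩ : ∃ m : ℕ, 0 < m ∧ 4 * ε * m < 1 + ε ∧
      1 / ε ≤ ((m : ℝ) + 1) ^ 3 := by
    have key : 1 / (4 * ε) * (4 * ε) = 1 := by field_simp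
    have hinv : 1 / ε = 4 * (1 / (4 * ε)) := by field_simp
    rcases lt_or_ge (1 / (4 * ε)) 1 with hlt | hge
    · refine ⟨1, one_pos, by norm_num; linarith, ?_⟩
      rw [hinv]
      norm_num
      norm_num at hlt
      linarith
    · have hx := Nat.floor_le (zero_le_one.trans hge)
      have hy := Nat.lt_floor_add_one (1 / (4 * ε))
      have h1 : 1 ≤ ⌊1 / (4 * ε)⌋₊ := Nat.one_le_floor_iff _ |>.mpr hge
      refine ⟨⌊1 / (4 * ε)⌋₊, h1, ?_, ?_⟩
      · nlinarith
      · have h1' : (1 : ℝ) ≤ ⌊1 / (4 * ε)⌋₊ := by exact_mod_cast h1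
        rw [hinv]
        generalize (⌊1 / (4 * ε)⌋₊ : ℝ) = t at *
        nlinarith [mul_nonneg (sub_nonneg.2 h1') (sub_nonneg.2 h1')]
  have hm' : (0 : ℝ) < m := by exact_mod_cast hm
  have hw : ∀ k : Fin (m + 1), 1 + (k : ℝ) / m ∈ Set.Icc (1 : ℝ) 2 := fun k ↦ by
    have : (k : ℝ) ≤ m := by exact_mod_cast Nat.lt_succ_iff.mp k.2
    have h1 : (k : ℝ) / m ≤ 1 := (div_le_one hm').2 this
    have h2 : 0 ≤ (k : ℝ) / m := by positivity
    exact ⟨by linarith, by linarith⟩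
  have hcard := logb_card_le_of_randomizedSketchable
    (fun f : {z : Sym2 (Fin n) // ¬ z.IsDiag} → Fin (m + 1) ↦
      BoundedMetric.ofSym2 (Φ := Φ) hΦ (fun z ↦ 1 + (f z : ℝ) / m) (fun z ↦ hw (f z)))
    (fun f g hfg E ↦ by
      obtain ⟨⟨z, hz⟩, hne⟩ := Function.ne_iff.mp hfg
      induction z with | _ i j
      apply HasDistortion.not_of_lt (i := i) (j := j)
      rw [BoundedMetric.ofSym2_dist _ _ _ hz, BoundedMetric.ofSym2_dist _ _ _ hz]
      rcases lt_or_gt_of_ne hne with hlt | hlt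
      · exact Or.inl (arithmetic_ratio_lt hm hε hmε hlt)
      · exact Or.inr (arithmetic_ratio_lt hm hε hmε hlt))
    hδ h
  rw [Fintype.card_fun, Sym2.card_subtype_not_diag, Fintype.card_fin, Fintype.card_fin,
    Nat.cast_pow, Real.logb_pow, Nat.cast_choose_two] at hcard
  push_cast at hcard
  have hlog : Real.logb 2 (1 / ε) ≤ 3 * Real.logb 2 ((m : ℝ) + 1) := by
    have := Real.logb_le_logb_of_le (b := 2) (by norm_num) (by positivity) hcube
    rwa [Real.logb_pow] at this
  have hn' : (2 : ℝ) ≤ n := by exact_mod_cast hn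
  have hlog0 : 0 ≤ Real.logb 2 ((m : ℝ) + 1) :=
    Real.logb_nonneg (by norm_num) (by linarith)
  have hq : (n : ℝ) ^ 2 ≤ 4 * (n * (n - 1) / 2) := by nlinarith
  calc (n : ℝ) ^ 2 * Real.logb 2 (1 / ε)
      ≤ (n : ℝ) ^ 2 * (3 * Real.logb 2 ((m : ℝ) + 1)) := by gcongr
    _ ≤ 4 * (n * (n - 1) / 2) * (3 * Real.logb 2 ((m : ℝ) + 1)) := by gcongr
    _ = 12 * (n * (n - 1) / 2 * Real.logb 2 ((m : ℝ) + 1)) := by ring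
    _ ≤ 24 * b := by linarith

theorem mul_logb_logb_le_of_randomizedSketchable {n : ℕ} {ε Φ δ : ℝ} {b : ℕ} (hn : 2 ≤ n)
    (hε : 0 < ε) (hε' : ε < 1 / 3) (hΦ : 2 ≤ Φ) (hδ : δ < 1)
    (h : RandomizedSketchable n ε Φ δ b) :
    (n : ℝ) * Real.logb 2 (Real.logb 2 Φ) ≤ 4 * b := by
  obtain ⟨n, rfl⟩ : ∃ k, n = k + 1 := ⟨n - 1, by omega⟩
  have hlog1 : 1 ≤ Real.logb 2 Φ := by
    rw [Real.le_logb_iff_rpow_le (by norm_num) (by linarith)]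
    simpa using hΦ
  set k := ⌊Real.logb 2 Φ⌋₊ with hk
  have hpow : ∀ a : Fin (k + 1), (2 : ℝ) ^ (a : ℕ) ≤ Φ := fun a ↦ by
    have ha : ((a : ℕ) : ℝ) ≤ Real.logb 2 Φ :=
      (Nat.cast_le.2 (Nat.lt_succ_iff.mp a.2)).trans (Nat.floor_le (by linarith))
    rw [Real.le_logb_iff_rpow_le (by norm_num) (by linarith)] at ha
    simpa using ha
  have hone : ∀ a : ℕ, (1 : ℝ) ≤ 2 ^ a := fun a ↦ one_le_pow₀ (by norm_num)
  -- Point `0` has weight zero, so its distances to the other points reveal all their weights.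
  let w : (Fin n → Fin (k + 1)) → Fin (n + 1) → ℝ :=
    fun f ↦ Fin.cons 0 (fun i ↦ (2 : ℝ) ^ (f i : ℕ))
  -- `ε < 1/3` means `(1 + ε)/(1 - ε) < 2`.
  have hratio : ∀ a a' : Fin (k + 1), a < a' →
      (1 + ε) * (2 : ℝ) ^ (a : ℕ) < (1 - ε) * 2 ^ (a' : ℕ) := fun a a' haa ↦ by
    have h2 : (2 : ℝ) * 2 ^ (a : ℕ) ≤ 2 ^ (a' : ℕ) := by
      rw [← pow_succ']
      exact pow_le_pow_right₀ (by norm_num) haa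
    have := hone a
    nlinarith
  have hcard := logb_card_le_of_randomizedSketchable
    (fun f : Fin n → Fin (k + 1) ↦ BoundedMetric.ofMax (Φ := Φ) (w f)
      (fun i j hij ↦ by
        induction i using Fin.cases with
        | zero =>
          induction j using Fin.cases with
          | zero => exact absurd rfl hij
          | succ j => exact le_max_of_le_right (hone _)
        | succ i => exact le_max_of_le_left (hone _))
      (fun i ↦ by
        induction i using Fin.cases with
        | zero => exact (by linarith : (0 : ℝ) ≤ Φ)
        | succ i => exact hpow _))
    (fun f g hfg E ↦ by
      obtain ⟨i, hne⟩ := Function.ne_iff.mp hfg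
      apply HasDistortion.not_of_lt (i := 0) (j := i.succ)
      have hmax : ∀ f, max (w f 0) (w f i.succ) = 2 ^ (f i : ℕ) := fun f ↦
        max_eq_right (zero_le_one.trans (hone _))
      rw [BoundedMetric.ofMax_dist _ _ _ (Fin.succ_ne_zero i).symm,
        BoundedMetric.ofMax_dist _ _ _ (Fin.succ_ne_zero i).symm, hmax, hmax]
      rcases lt_or_gt_of_ne hne with hlt | hlt
      · exact Or.inl (hratio _ _ hlt)
      · exact Or.inr (hratio _ _ hlt))
    hδ h
  rw [Fintype.card_fun, Fintype.card_fin, Fintype.card_fin, Nat.cast_pow, Real.logb_pow] at hcard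
  push_cast at hcard ⊢
  have hloglog : Real.logb 2 (Real.logb 2 Φ) ≤ Real.logb 2 ((k : ℝ) + 1) :=
    Real.logb_le_logb_of_le (by norm_num) (by linarith) (Nat.lt_floor_add_one _).le
  have hlog0 : 0 ≤ Real.logb 2 ((k : ℝ) + 1) :=
    Real.logb_nonneg (by norm_num) (by linarith [Nat.cast_nonneg (α := ℝ) k])
  have hn1 : (1 : ℝ) ≤ n := by exact_mod_cast (by omega : 1 ≤ n)
  calc ((n : ℝ) + 1) * Real.logb 2 (Real.logb 2 Φ)
      ≤ (n + 1) * Real.logb 2 ((k : ℝ) + 1) := by gcongr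
    _ ≤ (2 * n) * Real.logb 2 ((k : ℝ) + 1) := by gcongr; linarith
    _ ≤ 4 * b := by linarith

/-! ### Upper bound: hierarchical nets -/

/-- A hierarchy of nested nets of a metric `d` of diameter less than `2 ^ L`, in which the point `x`
belongs to the nets of scales `2 ^ 0, …, 2 ^ lev x`, and is covered at the next scale by
`par x`. -/
structure IsNetHierarchy {ι : Type*} (d : ι → ι → ℝ) (L : ℕ) (lev : ι → ℕ) (par : ι → ι) :
    Prop where
  lev_le : ∀ x, lev x ≤ L
  pow_le : ∀ x y, x ≠ y → (2 : ℝ) ^ min (lev x) (lev y) ≤ d x y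
  lev_lt_lev_par : ∀ x, lev x < L → lev x < lev (par x)
  dist_par_le : ∀ x, lev x < L → d x (par x) ≤ 2 ^ (lev x + 1)

/-- Take a pointwise maximal separated level function: a point without a parent could be raised by
one level. -/
theorem exists_isNetHierarchy {ι : Type*} [Finite ι] (d : ι → ι → ℝ)
    (hsymm : ∀ x y, d x y = d y x) (hone : ∀ x y, x ≠ y → 1 ≤ d x y) (L : ℕ) :
    ∃ lev par, IsNetHierarchy d L lev par := by
  classical
  let S : Set (ι → ℕ) :=
    {lev | (∀ x, lev x ≤ L) ∧ ∀ x y, x ≠ y → (2 : ℝ) ^ min (lev x) (lev y) ≤ d x y}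
  have hfin : S.Finite := by
    refine (Set.Finite.pi' (fun _ : ι ↦ Set.finite_Iic L)).subset ?_
    intro lev h x
    exact h.1 x
  have hne : S.Nonempty := ⟨fun _ ↦ 0, fun _ ↦ Nat.zero_le _, fun x y hxy ↦ by
    simpa using hone x y hxy⟩
  obtain ⟨lev, hlev⟩ := hfin.exists_maximal hne
  have hpar : ∀ x, ∃ y, lev x < L → lev x < lev y ∧ d x y ≤ 2 ^ (lev x + 1) := by
    intro x
    by_cases hx : lev x < L
    swap
    · exact ⟨x, fun h ↦ absurd h hx⟩
    by_contra! hcon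
    have hsep : ∀ y, y ≠ x → (2 : ℝ) ^ min (lev x + 1) (lev y) ≤ d x y := fun y hy ↦ by
      by_cases hxy : lev x < lev y
      · rw [min_eq_left hxy]
        exact ((hcon y).2 hxy).le
      · have := hlev.prop.2 x y hy.symm
        rw [min_eq_right (by omega)] at this ⊢
        exact this
    have hmem : Function.update lev x (lev x + 1) ∈ S := by
      refine ⟨fun y ↦ ?_, fun y z hyz ↦ ?_⟩
      · by_cases hy : y = x
        · subst hy; simpa using hx
        · simpa [hy] using hlev.prop.1 y
      · by_cases hy : y = x
        · subst hy
          simpa [hyz.symm] using hsep z hyz.symm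
        · by_cases hz : z = x
          · subst hz
            rw [hsymm, min_comm]
            simpa [hy] using hsep y hy
          · simpa [hy, hz] using hlev.prop.2 y z hyz
    have hle : lev ≤ Function.update lev x (lev x + 1) := by
      rw [le_update_iff]
      exact ⟨by omega, fun _ _ ↦ le_rfl⟩
    have := hlev.le_of_ge hmem hle x
    simp at this
  choose par hpar using hpar
  exact ⟨lev, par, hlev.prop.1, hlev.prop.2, fun x hx ↦ (hpar x hx).1, fun x hx ↦ (hpar x hx).2⟩

theorem IsNetHierarchy.exists_ancestor {ι : Type*} {d d' : ι → ι → ℝ} {L : ℕ} {lev : ι → ℕ}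
    {par : ι → ι} (h : IsNetHierarchy d L lev par) (h' : IsNetHierarchy d' L lev par)
    (hd : ∀ x, d x x = 0) (hd' : ∀ x, d' x x = 0) {l : ℕ} (hl : l < L) {x : ι} (hx : l ≤ lev x) :
    ∃ y, l < lev y ∧ d x y ≤ 2 * 2 ^ l ∧ d' x y ≤ 2 * 2 ^ l := by
  rcases hx.eq_or_lt with rfl | hlt
  · refine ⟨par x, h.lev_lt_lev_par x hl, ?_, ?_⟩
    · rw [← pow_succ']; exact h.dist_par_le x hl
    · rw [← pow_succ']; exact h'.dist_par_le x hl
  · exact ⟨x, hlt, by rw [hd]; positivity, by rw [hd']; positivity⟩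

/-- Two metrics with a common net hierarchy are close if, for each pair of points, either they
agree up to `η` times the scale of the pair, or both distances are much larger than that scale. -/
theorem IsNetHierarchy.abs_sub_le {ι : Type*} {d d' : ι → ι → ℝ} {L : ℕ} {lev : ι → ℕ}
    {par : ι → ι} (h : IsNetHierarchy d L lev par) (h' : IsNetHierarchy d' L lev par)
    (hd : ∀ x, d x x = 0) (hd' : ∀ x, d' x x = 0)
    (hL : ∀ x y, d x y < 2 ^ L)
    (hdd : ∀ x y x' y', |d x y - d x' y'| ≤ d x x' + d y y')
    (hdd' : ∀ x y x' y', |d' x y - d' x' y'| ≤ d' x x' + d' y y')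
    {η : ℝ} (hη : 0 < η) (hη' : 49 * η ≤ 1)
    (hclose : ∀ x y, x ≠ y → |d x y - d' x y| ≤ η * 2 ^ min (lev x) (lev y) ∨
      2 ^ min (lev x) (lev y) ≤ η * d x y)
    {x y : ι} (hxy : x ≠ y) :
    |d x y - d' x y| ≤ 49 * η * d x y := by
  -- Climbing the levels needs a slack `12 * T`. A climb from scale `2 ^ l` uses `T = 2 * 2 ^ l`
  -- above: of the slack `24 * 2 ^ l`, the four displacements take `8`, the change of `49 * η * d`
  -- takes at most `4`, and `12` remain. An uncapped pair ends the climb with error at most `η * d`,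
  -- whence `49 = 12 * 4 + 1`.
  suffices H : ∀ k, ∀ x y, x ≠ y → L - min (lev x) (lev y) ≤ k →
      ∀ T : ℝ, T ≤ 2 ^ min (lev x) (lev y) → T ≤ 4 * η * d x y →
        |d x y - d' x y| ≤ 49 * η * d x y - 12 * T by
    have h0 : 0 ≤ d x y := le_trans (by positivity) (h.pow_le x y hxy)
    simpa using H _ x y hxy le_rfl 0 (by positivity) (by positivity)
  intro k
  induction k with
  | zero =>
    intro x y hxy hk
    have := h.pow_le x y hxy
    have hle : min (lev x) (lev y) = L :=
      le_antisymm (min_le_of_left_le (h.lev_le x)) (by omega)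
    rw [hle] at this
    exact absurd (hL x y) this.not_gt
  | succ k ih =>
    intro x y hxy hk T hT hTd
    have hm := h.pow_le x y hxy
    rcases hclose x y hxy with hc | hc
    · nlinarith
    · set l := min (lev x) (lev y) with hl
      have hlL : l < L := by
        by_contra! hge
        have : (2 : ℝ) ^ L ≤ 2 ^ l := pow_le_pow_right₀ (by norm_num) hge
        linarith [hL x y]
      obtain ⟨x', hx', hdx, hdx'⟩ := h.exists_ancestor h' hd hd' hlL (min_le_left (lev x) (lev y))
      obtain ⟨y', hy', hdy, hdy'⟩ := h.exists_ancestor h' hd hd' hlL (min_le_right (lev x) (lev y))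
      have e1 := abs_le.1 (hdd x y x' y')
      have e2 := abs_le.1 (hdd' x y x' y')
      have hpos : (0 : ℝ) < 2 ^ l := by positivity
      have hll : (2 : ℝ) * 2 ^ l ≤ 2 ^ min (lev x') (lev y') := by
        rw [← pow_succ']
        exact pow_le_pow_right₀ (by norm_num) (le_min hx' hy')
      have hne : x' ≠ y' := by
        rintro rfl
        rw [hd] at e1
        nlinarith
      have hT' : 2 * 2 ^ l ≤ 4 * η * d x' y' := by nlinarith
      have e3 := abs_le.1 (ih x' y' hne (by omega) (2 * 2 ^ l) hll hT')
      have e4 : 49 * η * d x' y' ≤ 49 * η * d x y + 4 * 2 ^ l := by nlinarith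
      rw [abs_le]
      constructor <;> linarith [e1.1, e1.2, e2.1, e2.2, e3.1, e3.2]

/-! ### Encoding by capped rounding -/

/-- Below the cap, both numbers lie in one cell of width `η * u`; at the cap, `r ≥ K * η * u ≥ u /
η`. -/
theorem abs_sub_le_or_of_min_floor_eq {r s u η : ℝ} (hr : 0 ≤ r) (hs : 0 ≤ s) (hu : 0 < u)
    (hη : 0 < η) {K : ℕ} (hK : 1 / η ^ 2 ≤ K)
    (h : min ⌊r / (η * u)⌋₊ K = min ⌊s / (η * u)⌋₊ K) :
    |r - s| ≤ η * u ∨ u ≤ η * r := by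
  have hηu : 0 < η * u := by positivity
  have hr1 := Nat.floor_le (div_nonneg hr hηu.le)
  have hr2 := Nat.lt_floor_add_one (r / (η * u))
  have hs1 := Nat.floor_le (div_nonneg hs hηu.le)
  have hs2 := Nat.lt_floor_add_one (s / (η * u))
  rw [le_div_iff₀ hηu] at hr1 hs1
  rw [div_lt_iff₀ hηu] at hr2 hs2
  rcases lt_or_ge ⌊r / (η * u)⌋₊ K with hlt | hge
  · left
    have heq : ⌊s / (η * u)⌋₊ = ⌊r / (η * u)⌋₊ := by omega
    rw [heq] at hs1 hs2
    rw [abs_le]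
    constructor <;> linarith
  · right
    have hge' : (K : ℝ) ≤ ⌊r / (η * u)⌋₊ := by exact_mod_cast hge
    have h1 : 1 / η ^ 2 * (η * u) ≤ r :=
      (mul_le_mul_of_nonneg_right (hK.trans hge') hηu.le).trans hr1
    calc u = η * (1 / η ^ 2 * (η * u)) := by field_simp
      _ ≤ η * r := by gcongr

/-- It suffices to assign to each metric one of `2 ^ b` labels such that metrics of the same label
approximate one another. -/
theorem Sketchable.of_labelling {n : ℕ} {ε Φ : ℝ} {T : Type*} [Fintype T]
    (code : BoundedMetric n Φ → T)
    (hcode : ∀ d d', code d = code d' → HasDistortion ε d (fun i j ↦ d'.metric.dist i j)) :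
    Sketchable n ε Φ (Nat.clog 2 (Fintype.card T)) := by
  classical
  set b := Nat.clog 2 (Fintype.card T)
  obtain ⟨f⟩ : Nonempty (T ↪ (Fin b → Bool)) := by
    rw [Function.Embedding.nonempty_iff_card_le]
    simpa using Nat.le_pow_clog (by norm_num) _
  let sketch : BoundedMetric n Φ → List Bool := fun d ↦ List.ofFn (f (code d))
  -- The default `0` is never reached on an actual sketch.
  refine ⟨sketch, fun s i j ↦ if h : ∃ d, sketch d = s then h.choose.metric.dist i j else 0,
    fun d ↦ ⟨by simp [sketch], ?_⟩⟩
  have hex : ∃ d', sketch d' = sketch d := ⟨d, rfl⟩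
  simp only [hex, dite_true]
  exact hcode _ _ (f.injective (List.ofFn_injective hex.choose_spec)).symm

theorem exists_sketchable_clog {n : ℕ} {η Φ : ℝ} (hη : 0 < η) (hη' : 49 * η ≤ 1) {K L : ℕ}
    (hK : 1 / η ^ 2 ≤ K) (hL : Φ < 2 ^ L) :
    Sketchable n (49 * η) Φ (Nat.clog 2 (((L + 1) * n * (K + 1) ^ n) ^ n)) := by
  have hex : ∀ d : BoundedMetric n Φ,
      ∃ lev par, IsNetHierarchy (fun i j ↦ d.metric.dist i j) L lev par := fun d ↦
    exists_isNetHierarchy _ (fun i j ↦ d.metric.dist_comm i j) d.one_le_dist L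
  choose lev par hnet using hex
  let code : BoundedMetric n Φ → Fin n → Fin (L + 1) × Fin n × (Fin n → Fin (K + 1)) :=
    fun d i ↦ (⟨lev d i, Nat.lt_succ_of_le ((hnet d).lev_le i)⟩, par d i, fun j ↦
      ⟨min ⌊d.metric.dist i j / (η * 2 ^ min (lev d i) (lev d j))⌋₊ K,
        Nat.lt_succ_of_le (min_le_right _ _)⟩)
  have hdiam : ∀ (d : BoundedMetric n Φ) i j, d.metric.dist i j < 2 ^ L := fun d i j ↦ by
    by_cases hij : i = j
    · rw [hij, d.metric.dist_self]; positivity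
    · exact (d.dist_le i j hij).trans_lt hL
  have hquad : ∀ (d : BoundedMetric n Φ) i j i' j',
      |d.metric.dist i j - d.metric.dist i' j'| ≤ d.metric.dist i i' + d.metric.dist j j' :=
    fun d i j i' j' ↦ by
      let := d.metric
      exact dist_dist_dist_le i j i' j'
  have hnonneg : ∀ (d : BoundedMetric n Φ) i j, 0 ≤ d.metric.dist i j := fun d i j ↦ by
    let := d.metric
    exact dist_nonneg
  have hcode : ∀ d d', code d = code d' →
      HasDistortion (49 * η) d (fun i j ↦ d'.metric.dist i j) := fun d d' hdd i j ↦ by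
    have hlev : lev d = lev d' := funext fun i ↦ by
      simpa [code] using congrArg (fun t ↦ (t i).1) hdd
    have hpar : par d = par d' := funext fun i ↦ congrArg (fun t ↦ (t i).2.1) hdd
    have hfl : ∀ i j, min ⌊d.metric.dist i j / (η * 2 ^ min (lev d i) (lev d j))⌋₊ K =
        min ⌊d'.metric.dist i j / (η * 2 ^ min (lev d i) (lev d j))⌋₊ K := fun i j ↦ by
      have := congrArg (fun t ↦ ((t i).2.2 j : ℕ)) hdd
      simpa only [code, hlev] using this
    by_cases hij : i = j
    · subst hij
      simp
    · have hnet' := hnet d'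
      -- Equal codes make this one hierarchy valid for both metrics.
      rw [← hlev, ← hpar] at hnet'
      have key := (hnet d).abs_sub_le hnet' d.metric.dist_self d'.metric.dist_self (hdiam d)
        (hquad d) (hquad d') hη hη'
        (fun x y _ ↦ abs_sub_le_or_of_min_floor_eq (hnonneg d x y) (hnonneg d' x y)
          (by positivity) hη hK (hfl x y)) hij
      rw [abs_le] at key
      constructor <;> linarith [key.1, key.2]
  have := Sketchable.of_labelling code hcode
  simpa [Fintype.card_fun, Fintype.card_prod, mul_assoc] using this

theorem Sketchable.mono {n : ℕ} {ε ε' Φ : ℝ} {b : ℕ} (h : ε ≤ ε') (hs : Sketchable n ε Φ b) :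
    Sketchable n ε' Φ b := by
  obtain ⟨sketch, estimate, H⟩ := hs
  refine ⟨sketch, estimate, fun d ↦ ⟨(H d).1, fun i j ↦ ?_⟩⟩
  have hnonneg : 0 ≤ d.metric.dist i j := by
    let := d.metric
    exact dist_nonneg
  obtain ⟨h1, h2⟩ := (H d).2 i j
  constructor <;> nlinarith

theorem exists_sketchable_of_le_half {n : ℕ} {ε Φ : ℝ} (hε : 0 < ε) (hε' : ε ≤ 1 / 2)
    (hΦ : 2 ≤ Φ) : ∃ b : ℕ, (b : ℝ) ≤ 20 * sketchBits n ε Φ ∧ Sketchable n ε Φ b := by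
  have hlogΦ : 1 ≤ Real.logb 2 Φ := by
    rw [Real.le_logb_iff_rpow_le (by norm_num) (by linarith)]
    simpa using hΦ
  have hlogε : 1 ≤ Real.logb 2 (1 / ε) := by
    rw [Real.le_logb_iff_rpow_le (by norm_num) (by positivity), le_div_iff₀ hε]
    norm_num
    linarith
  set L := ⌊Real.logb 2 Φ⌋₊ + 1 with hLdef
  set K := ⌈1 / (ε / 49) ^ 2⌉₊ with hKdef
  have hL : Φ < 2 ^ L := by
    have : Real.logb 2 Φ < (L : ℝ) := by
      rw [hLdef]; push_cast; exact Nat.lt_floor_add_one _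
    rw [Real.logb_lt_iff_lt_rpow (by norm_num) (by linarith)] at this
    simpa using this
  refine ⟨_, ?_, (exists_sketchable_clog (n := n) (η := ε / 49) (K := K) (L := L) (by positivity)
    (by linarith) (Nat.le_ceil _) hL).mono (by linarith)⟩
  -- For `n = 0` the budget is zero and could not absorb the rounding `+ 1` below.
  rcases Nat.eq_zero_or_pos n with rfl | hn
  · simp [sketchBits]
  have hn1 : (1 : ℝ) ≤ n := by exact_mod_cast hn
  have hnpos : (0 : ℝ) < n := by linarith
  set N := ((L + 1) * n * (K + 1) ^ n) ^ n with hN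
  have hNpos : 1 ≤ N := Nat.one_le_iff_ne_zero.2 (by positivity)
  have hclog : (Nat.clog 2 N : ℝ) ≤ Real.logb 2 N + 1 := by
    have := Real.natCeil_logb_natCast 2 N
    rw [← this]
    exact (Nat.ceil_lt_add_one (Real.logb_nonneg (by norm_num) (by exact_mod_cast hNpos))).le
  have hlogN : Real.logb 2 N =
      n * (Real.logb 2 (L + 1) + Real.logb 2 n + n * Real.logb 2 (K + 1)) := by
    rw [hN]
    push_cast
    rw [Real.logb_pow, Real.logb_mul (by positivity) (by positivity),
      Real.logb_mul (by positivity) (by positivity), Real.logb_pow]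
  have hlogL : Real.logb 2 (L + 1) ≤ 2 + Real.logb 2 (Real.logb 2 Φ) := by
    have h4 : (2 : ℝ) = Real.logb 2 (2 ^ 2) := by rw [Real.logb_pow]; simp
    nth_rewrite 2 [h4]
    rw [← Real.logb_mul (by norm_num) (by linarith)]
    refine Real.logb_le_logb_of_le (by norm_num) (by positivity) ?_
    rw [hLdef]
    push_cast
    linarith [Nat.floor_le (zero_le_one.trans hlogΦ)]
  have hlogn : Real.logb 2 n ≤ n := by
    rw [Real.logb_le_iff_le_rpow (by norm_num) hnpos, Real.rpow_natCast]
    exact_mod_cast (Nat.lt_two_pow_self).le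
  have hlogK : Real.logb 2 (K + 1) ≤ 12 + 2 * Real.logb 2 (1 / ε) := by
    have h12 : (12 : ℝ) = Real.logb 2 (2 ^ 12) := by rw [Real.logb_pow]; norm_num
    have hsq : 2 * Real.logb 2 (1 / ε) = Real.logb 2 ((1 / ε) ^ 2) := by
      rw [Real.logb_pow]; norm_num
    rw [h12, hsq, ← Real.logb_mul (by norm_num) (by positivity)]
    refine Real.logb_le_logb_of_le (by norm_num) (by positivity) ?_
    have hceil : (K : ℝ) < 1 / (ε / 49) ^ 2 + 1 := Nat.ceil_lt_add_one (by positivity)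
    have hexp : 1 / (ε / 49) ^ 2 = 2401 * (1 / ε) ^ 2 := by field_simp; norm_num
    have h2 : 2 ≤ 1 / ε := by rw [le_div_iff₀ hε]; linarith
    rw [hexp] at hceil
    nlinarith
  have hloglog : 0 ≤ Real.logb 2 (Real.logb 2 Φ) := Real.logb_nonneg (by norm_num) hlogΦ
  have hsqlog : (n : ℝ) ^ 2 ≤ n ^ 2 * Real.logb 2 (1 / ε) :=
    le_mul_of_one_le_right (by positivity) hlogε
  have hnsq : (n : ℝ) ≤ n ^ 2 := by nlinarith
  calc (Nat.clog 2 N : ℝ)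
      ≤ n * (Real.logb 2 (L + 1) + Real.logb 2 n + n * Real.logb 2 (K + 1)) + 1 := hlogN ▸ hclog
    _ ≤ n * ((2 + Real.logb 2 (Real.logb 2 Φ)) + n + n * (12 + 2 * Real.logb 2 (1 / ε))) + 1 := by
        gcongr
    _ = (2 * n ^ 2 * Real.logb 2 (1 / ε) + n * Real.logb 2 (Real.logb 2 Φ)) +
          (2 * n + 13 * n ^ 2 + 1) := by ring
    _ ≤ 20 * sketchBits n ε Φ := by
        have := mul_nonneg hnpos.le hloglog
        unfold sketchBits
        linarith

theorem theorem1p2 :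
    -- sufficient, already for deterministic sketching
    (∀ ε₁ : ℝ, ε₁ < 1 → ∃ C : ℝ, 0 < C ∧
      ∀ (n : ℕ) (ε Φ : ℝ), 0 < ε → ε ≤ ε₁ → 2 ≤ Φ →
        ∃ b : ℕ, (b : ℝ) ≤ C * sketchBits n ε Φ ∧ Sketchable n ε Φ b) ∧
    -- necessary, even for randomized sketching
    (∃ c : ℝ, 0 < c ∧
      ∀ (n : ℕ) (ε Φ δ : ℝ), 2 ≤ n → 0 < ε → ε < 1 / 3 → 2 ≤ Φ → 0 ≤ δ → δ < 1 →
        ∀ b : ℕ, RandomizedSketchable n ε Φ δ b → c * sketchBits n ε Φ ≤ (b : ℝ)) := by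
  constructor
  · intro ε₁ hε₁
    rcases le_or_gt ε₁ 0 with hneg | hpos
    · exact ⟨1, one_pos, fun n ε Φ h0 h1 ↦ absurd (h0.trans_le h1) hneg.not_gt⟩
    set l := Real.logb 2 (1 / ε₁) with hl
    have hl0 : 0 < l := Real.logb_pos (by norm_num) (by rw [lt_div_iff₀ hpos]; linarith)
    -- For `ε > 1/2`, sketch with distortion `1/2` instead: its logarithm is `1`, at most `log(1/ε)
    -- / l`.
    refine ⟨20 * (1 + 1 / l), by positivity, fun n ε Φ hε hεε₁ hΦ ↦ ?_⟩
    obtain ⟨b, hb, hs⟩ := exists_sketchable_of_le_half (n := n) (ε := min ε (1 / 2)) (Φ := Φ)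
      (lt_min hε (by norm_num)) (min_le_right _ _) hΦ
    refine ⟨b, hb.trans ?_, hs.mono (min_le_left _ _)⟩
    have hlogΦ : 1 ≤ Real.logb 2 Φ := by
      rw [Real.le_logb_iff_rpow_le (by norm_num) (by linarith)]
      simpa using hΦ
    have hloglog : 0 ≤ Real.logb 2 (Real.logb 2 Φ) := Real.logb_nonneg (by norm_num) hlogΦ
    have hle : l ≤ Real.logb 2 (1 / ε) :=
      Real.logb_le_logb_of_le (by norm_num) (one_div_pos.2 hpos) (one_div_le_one_div_of_le hε hεε₁)
    have hlog : Real.logb 2 (1 / min ε (1 / 2)) ≤ (1 + 1 / l) * Real.logb 2 (1 / ε) := by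
      have h1 : 1 ≤ 1 / l * Real.logb 2 (1 / ε) := by
        rw [one_div_mul_eq_div, le_div_iff₀ hl0]; linarith
      rcases le_total ε (1 / 2) with h | h
      · rw [min_eq_left h]; linarith
      · rw [min_eq_right h]
        norm_num at h1 hle ⊢
        linarith
    have h2 : 1 ≤ 1 + 1 / l := by linarith [one_div_pos.2 hl0]
    unfold sketchBits
    calc 20 * ((n : ℝ) ^ 2 * Real.logb 2 (1 / min ε (1 / 2)) + n * Real.logb 2 (Real.logb 2 Φ))
        ≤ 20 * ((n : ℝ) ^ 2 * ((1 + 1 / l) * Real.logb 2 (1 / ε)) +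
            (1 + 1 / l) * (n * Real.logb 2 (Real.logb 2 Φ))) := by
          refine mul_le_mul_of_nonneg_left (add_le_add (by gcongr) ?_) (by norm_num)
          exact le_mul_of_one_le_left (mul_nonneg n.cast_nonneg hloglog) h2
      _ = _ := by ring
  · refine ⟨1 / 28, by norm_num, fun n ε Φ δ hn hε hε' hΦ _ hδ b h ↦ ?_⟩
    have h1 := sq_mul_logb_le_of_randomizedSketchable hn hε hε' hΦ hδ h
    have h2 := mul_logb_logb_le_of_randomizedSketchable hn hε hε' hΦ hδ h
    unfold sketchBits
    linarith
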